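/- Let $d\ge 1$ and let $T_d$ be the $d$-regular tree, with vertex set $V$. A factor-of-IID process on $T_d$ with state space $\{0,1\}$ is a process $(X_v)_{v\in V}=\Phi\big((Z_v)_{v\in V}\big)$, where the $Z_v$ are independent and uniform on $[0,1]$ and $\Phi\colon[0,1]^V\to\{0,1\}^V$ is measurable and $\mathrm{Aut}(T_d)$-equivariant. If almost surely there are no neighbouring vertices $u,v$ with $X_u=X_v=1$, then $X$ is called a factor-of-IID independent set, and $q=P(X_v=1)$, which does not depend on $v$, is its density. Let $f\colon[0,1]\to\mathbb R$ be concave with $f(0)=f(1)=0$. Let $T=\{(x,y)\in\mathbb R^2: x,y\ge 0,\ x+y\le 1\}$ and let $F\colon T\to\mathbb R$ satisfy $F(0,0)=F(0,1)=F(1,0)=0$, such that the functions $F(x,y)-f(x)$ and $F(x,y)-f(y)$ are both concave on $T$. Then $$F(q,q)\ \ge\ \frac{2(d-1)}{d}\,f(q)$$ whenever $q$ is the density of a factor-of-IID independent set on $T_d$, and also when $q$ is the supremum of all such densities. -/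

import Mathlib

open MeasureTheory

/-- The law of the IID process on `V`: independent labels `Z v`, each uniform on `[0,1]`. -/
noncomputable def iidLaw (V : Type*) : Measure (V → unitInterval) :=
  Measure.infinitePi (fun _ : V => (volume : Measure unitInterval))

/-- A factor map on the graph `G` with state space `M`: a measurable map from `[0,1]`-labellings
to `M`-labellings of the vertices that commutes with every automorphism of `G`. -/
structure IsFactorMap {V M : Type*} [MeasurableSpace M] (G : SimpleGraph V)
    (Φ : (V → unitInterval) → (V → M)) : Prop where
  measurable : Measurable Φ
  equivariant : ∀ (φ : G ≃g G) (z : V → unitInterval),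
    Φ (fun v => z (φ v)) = fun v => Φ z (φ v)

/-- `μ` is the law of a factor-of-IID process `(X v)` on `G` with state space `M`: the image of
the IID process under a factor map. -/
def IsFactorOfIID {V M : Type*} [MeasurableSpace M] (G : SimpleGraph V)
    (μ : Measure (V → M)) : Prop :=
  ∃ Φ : (V → unitInterval) → (V → M), IsFactorMap G Φ ∧ μ = (iidLaw V).map Φ

/-- `μ` is the law of a random independent set of `G`, encoded by its indicator
(`true` = state `1`, `false` = state `0`): almost surely no two neighbours are both in the set. -/
def IsRandomIndepSet {V : Type*} (G : SimpleGraph V) (μ : Measure (V → Bool)) : Prop :=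
  ∀ᵐ x ∂μ, ∀ u v : V, G.Adj u v → ¬ (x u = true ∧ x v = true)

/-- The densities of the factor-of-IID independent sets of `G`. On a vertex-transitive graph
the probability that `v` belongs to the set is the same for all vertices `v`, by invariance. -/
def fiidIndepDensities {V : Type*} (G : SimpleGraph V) : Set ℝ :=
  {q | ∃ μ : Measure (V → Bool), IsFactorOfIID G μ ∧ IsRandomIndepSet G μ ∧
    ∀ v : V, μ.real {x | x v = true} = q}

/-- The triangle with vertices `(0,0)`, `(1,0)`, `(0,1)`. -/
def triangleT : Set (ℝ × ℝ) := {p | 0 ≤ p.1 ∧ 0 ≤ p.2 ∧ p.1 + p.2 ≤ 1}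

/-! Take first an event `A` ("the root `o` is in the set") that depends on finitely many labels from
a finite alphabet. Reveal the labels in a uniformly random order and follow the mean of `f` at the
conditional probability of `A`. It falls from `f q` to `0`, since `f` vanishes at `0` and `1`, and
the Shapley values split this total fall among the labels (`sum_shapley`); concavity of `f` makes
every share nonnegative.

For an edge from `o` to `v`, the mean of `F` at the two conditional probabilities falls from `F (q,
q)` to `0`, since disjoint events end at a vertex of the triangle other than `(1, 1)`. Concavity of
`F - f(x)` and `F - f(y)` says that each label's share of this fall is at least its share for either
endpoint alone. Charge each label to the endpoint nearer to it. An automorphism that inverts the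
edge exchanges the two sides, so `F (q, q)` is at least `2 f q` minus twice the shares, for `o`, of
the labels nearer to `v` (`IsTree.two_mul_sub_le`). Sum over the `d` neighbours `v`: in a tree a
label is nearer to at most one of them than to `o`, so the subtracted shares total at most `2 f q`.
This gives `d F (q, q) ≥ (2d - 2) f q`.

A general factor is approximated by such events, so its density is a limit of numbers satisfying all
the inequalities (`fiidIndepDensities_subset_closure`). The functions may jump at the boundary of
their domains, so passing to the limit needs care at `q = 0` and `q = 1/2`
(`closure_edgeInequalitySet_subset`). -/

/-! ### Regular trees: recursion from a root, edge colourings, edge inversions. -/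

namespace SimpleGraph

variable {V : Type*} {G : SimpleGraph V}

/-- In a tree, a vertex has at most one neighbour that is closer to a given root. -/
lemma IsTree.eq_of_adj_of_dist_add_one (hG : G.IsTree) {a v u u' : V}
    (hu : G.Adj u v) (hu' : G.Adj u' v) (h : G.dist a u + 1 = G.dist a v)
    (h' : G.dist a u' + 1 = G.dist a v) : u = u' := by
  obtain ⟨p, hp⟩ := hG.connected.exists_walk_length_eq_dist a u
  obtain ⟨p', hp'⟩ := hG.connected.exists_walk_length_eq_dist a u'
  have h1 : (p.concat hu).IsPath :=
    Walk.isPath_of_length_eq_dist _ (by rw [Walk.length_concat, hp, h])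
  have h2 : (p'.concat hu').IsPath :=
    Walk.isPath_of_length_eq_dist _ (by rw [Walk.length_concat, hp', h'])
  have h3 := congrArg Subtype.val
    ((hG.isAcyclic.subsingleton_path a v).elim ⟨_, h1⟩ ⟨_, h2⟩)
  have h4 := congrArg Walk.penultimate h3
  simpa using h4

lemma Connected.exists_adj_dist_add_one (hG : G.Connected) {a v : V} (h : v ≠ a) :
    ∃ u, G.Adj u v ∧ G.dist a u + 1 = G.dist a v := by
  obtain ⟨p, hp⟩ := hG.exists_walk_length_eq_dist a v
  have hnil : ¬ p.Nil := Walk.not_nil_of_ne h.symm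
  refine ⟨p.penultimate, p.adj_penultimate hnil, ?_⟩
  have h1 : G.dist a p.penultimate ≤ p.dropLast.length := dist_le _
  have h2 : p.dropLast.length + 1 = p.length := by
    have := congrArg Walk.length (p.concat_dropLast (p.adj_penultimate hnil))
    rwa [Walk.length_concat] at this
  have h3 := hG.dist_triangle (u := a) (v := p.penultimate) (w := v)
  rw [dist_eq_one_iff_adj.2 (p.adj_penultimate hnil)] at h3
  omega

/-- Functions on a rooted tree can be defined by recursion from the root outwards. -/
lemma IsTree.exists_rec (hG : G.IsTree) (a : V) {α : Type*} (b : α) (step : V → V → α → α) :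
    ∃ g : V → α, g a = b ∧
      ∀ u v, G.Adj u v → G.dist a u + 1 = G.dist a v → g v = step u v (g u) := by
  have hpar : ∀ v, ∃ u, v ≠ a → G.Adj u v ∧ G.dist a u + 1 = G.dist a v := fun v => by
    by_cases h : v = a
    · exact ⟨v, fun h' => absurd h h'⟩
    · obtain ⟨u, hu⟩ := hG.connected.exists_adj_dist_add_one h
      exact ⟨u, fun _ => hu⟩
  choose par hpar using hpar
  -- The counter `n` stands for the distance from the root; values of `K n v` at any other `n` are
  -- never used.
  let K : ℕ → V → α := fun n =>
    Nat.rec (fun _ => b) (fun _ k v => step (par v) v (k (par v))) n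
  refine ⟨fun v => K (G.dist a v) v, by simp [K], fun u v huv hd => ?_⟩
  have hva : v ≠ a := by rintro rfl; simp at hd
  have hu : par v = u :=
    hG.eq_of_adj_of_dist_add_one (hpar v hva).1 huv (hpar v hva).2 hd
  change K (G.dist a v) v = step u v (K (G.dist a u) u)
  rw [← hd]
  change step (par v) v (K (G.dist a u) (par v)) = _
  rw [hu]

/-- A regular tree has a proper edge colouring with as many colours as its degree. The colour
`i` is described by the involution `σ i` that moves every vertex along its edge of colour `i`. -/
lemma IsTree.exists_edge_involutions [G.LocallyFinite] (hG : G.IsTree) {d : ℕ} (hd : 1 ≤ d)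
    (hreg : G.IsRegularOfDegree d) :
    ∃ σ : Fin d → V → V, (∀ i v, σ i (σ i v) = v) ∧ (∀ i v, G.Adj v (σ i v)) ∧
      (∀ v i j, σ i v = σ j v → i = j) ∧ ∀ v w, G.Adj v w → ∃ i, σ i v = w := by
  classical
  obtain ⟨a⟩ := hG.connected.nonempty
  have e : ∀ v, Nonempty (G.neighborSet v ≃ Fin d) := fun v =>
    ⟨Fintype.equivFinOfCardEq (by rw [card_neighborSet_eq_degree, hreg v])⟩
  let e := fun v => (e v).some
  have hpar : ∀ v, ∃ u : G.neighborSet v, v ≠ a → G.dist a u + 1 = G.dist a v := fun v => by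
    by_cases h : v = a
    · exact ⟨(e v).symm ⟨0, hd⟩, fun h' => absurd h h'⟩
    · obtain ⟨u, hu, hu'⟩ := hG.connected.exists_adj_dist_add_one h
      exact ⟨⟨u, hu.symm⟩, fun _ => hu'⟩
  choose par hpar using hpar
  -- `g v` is the colour of the edge from `v` to its parent. Each vertex starts from an arbitrary
  -- numbering `e` of its edges, corrected by the one transposition that gives the parent edge the
  -- colour already chosen. The root uses an arbitrary neighbour as its parent here, which does no
  -- harm.
  obtain ⟨g, -, hg⟩ := hG.exists_rec a (⟨0, hd⟩ : Fin d) fun u v k =>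
    if h : G.Adj u v then Equiv.swap (e u (par u)) k (e u ⟨v, h⟩) else k
  let c : ∀ u, G.neighborSet u ≃ Fin d := fun u => (e u).trans (Equiv.swap (e u (par u)) (g u))
  have hcpar : ∀ u v (h : G.Adj u v), G.dist a u + 1 = G.dist a v →
      c u ⟨v, h⟩ = g v ∧ c v ⟨u, h.symm⟩ = g v := by
    intro u v h hd'
    constructor
    · simp [c, hg u v h hd', h]
    · have hva : v ≠ a := by rintro rfl; simp at hd'
      have : par v = ⟨u, h.symm⟩ := Subtype.ext <|
        hG.eq_of_adj_of_dist_add_one (SimpleGraph.Adj.symm (par v).2) h (hpar v hva) hd'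
      simp [c, this]
  have hsymm : ∀ u v (h : G.Adj u v), c u ⟨v, h⟩ = c v ⟨u, h.symm⟩ := by
    intro u v h
    rcases hG.dist_eq_dist_add_one_of_adj a h with h1 | h1
    · have := hcpar v u h.symm h1.symm
      rw [this.1, this.2]
    · have := hcpar u v h h1.symm
      rw [this.1, this.2]
  have hadj : ∀ i v, G.Adj v ((c v).symm i) := fun i v => ((c v).symm i).2
  refine ⟨fun i v => (c v).symm i, fun i v => ?_, hadj, fun v i j h => ?_, fun v w h => ?_⟩
  · have h1 := ((c v).apply_symm_apply i).symm.trans (hsymm v _ (hadj i v))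
    exact congrArg Subtype.val ((Equiv.symm_apply_eq _).2 h1)
  · exact (c v).symm.injective (Subtype.ext h)
  · exact ⟨c v ⟨w, h⟩, by simp⟩

/-- Any vertex is reached from `a` by a word in the colour moves, and both maps carry that word
along. -/
lemma Connected.eq_of_comm_involutions (hG : G.Connected) {ι : Type*} {σ : ι → V → V}
    (hσ : ∀ v w, G.Adj v w → ∃ i, σ i v = w) {τ τ' : V → V}
    (hτ : ∀ i v, τ (σ i v) = σ i (τ v)) (hτ' : ∀ i v, τ' (σ i v) = σ i (τ' v)) {a : V}
    (ha : τ a = τ' a) : τ = τ' := by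
  ext v
  obtain ⟨p⟩ := hG.preconnected a v
  induction p with
  | nil => exact ha
  | cons h p ih =>
    apply ih
    obtain ⟨i, rfl⟩ := hσ _ _ h
    rw [hτ, hτ', ha]

/-- Read the colours along the path from `a` and follow the same colours from `b`. Paths in a tree
are unique, so this is well defined. -/
lemma IsTree.exists_comm_involutions (hG : G.IsTree) {ι : Type*} {σ : ι → V → V}
    (hσσ : ∀ i v, σ i (σ i v) = v) (hadj : ∀ i v, G.Adj v (σ i v))
    (hinj : ∀ v i j, σ i v = σ j v → i = j) (a b : V) :
    ∃ τ : V → V, τ a = b ∧ ∀ i v, τ (σ i v) = σ i (τ v) := by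
  classical
  obtain ⟨τ, h1, h2⟩ := hG.exists_rec a b fun u v x =>
    if h : ∃ i, σ i u = v then σ h.choose x else x
  have key : ∀ i v, G.dist a v + 1 = G.dist a (σ i v) → τ (σ i v) = σ i (τ v) := by
    intro i v hd
    have hex : ∃ j, σ j v = σ i v := ⟨i, rfl⟩
    rw [h2 v (σ i v) (hadj i v) hd, dif_pos hex, hinj _ _ _ hex.choose_spec]
  refine ⟨τ, h1, fun i v => ?_⟩
  -- The recursion gives commutation on edges leading away from `a`; the reverse direction follows
  -- because `σ i` is an involution.
  rcases hG.dist_eq_dist_add_one_of_adj a (hadj i v) with h | h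
  · have := key i (σ i v) (by rw [hσσ, h])
    rw [hσσ] at this
    rw [this, hσσ]
  · exact key i v h.symm

/-- Every edge of a regular tree is inverted by an involutive automorphism. -/
theorem IsTree.exists_inversion [G.LocallyFinite] (hG : G.IsTree) {d : ℕ} (hd : 1 ≤ d)
    (hreg : G.IsRegularOfDegree d) {u v : V} (huv : G.Adj u v) :
    ∃ γ : G ≃g G, γ u = v ∧ ∀ w, γ (γ w) = w := by
  obtain ⟨σ, hσσ, hadj, hinj, hσ⟩ := hG.exists_edge_involutions hd hreg
  obtain ⟨τ, hτ, hc⟩ := hG.exists_comm_involutions hσσ hadj hinj u v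
  have hττ : τ ∘ τ = id := by
    refine hG.connected.eq_of_comm_involutions hσ (a := u) (fun i w => by simp [hc])
      (fun i w => rfl) ?_
    obtain ⟨i, rfl⟩ := hσ u v huv
    simp [hτ, hc, hσσ]
  have hinv : ∀ w, τ (τ w) = w := congrFun hττ
  have hmap : ∀ x y, G.Adj x y → G.Adj (τ x) (τ y) := by
    intro x y h
    obtain ⟨i, rfl⟩ := hσ x y h
    rw [hc]
    exact hadj i _
  refine ⟨⟨⟨τ, τ, hinv, hinv⟩, fun {x y} => ⟨fun h => ?_, hmap x y⟩⟩, hτ, hinv⟩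
  have := hmap _ _ h
  simpa [hinv] using this

lemma Iso.dist_map {V' : Type*} {G' : SimpleGraph V'} (hG : G.Connected) (γ : G ≃g G')
    (u v : V) : G'.dist (γ u) (γ v) = G.dist u v := by
  have hG' : G'.Connected := (Iso.connected_iff γ).1 hG
  apply le_antisymm
  · obtain ⟨p, hp⟩ := hG.exists_walk_length_eq_dist u v
    rw [← hp, ← p.length_map γ.toHom]
    exact dist_le _
  · obtain ⟨p, hp⟩ := hG'.exists_walk_length_eq_dist (γ u) (γ v)
    rw [← hp, ← p.length_map γ.symm.toHom]
    have := dist_le (p.map γ.symm.toHom)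
    simpa using this

end SimpleGraph

/-! ### Shapley values of set functions. -/

section Shapley

variable {V : Type*} [DecidableEq V]

/-- The probability that, in a uniformly random order of `n` elements, the set of elements that
come before a given one is a given set of size `s`. -/
noncomputable def shapleyWeight (n s : ℕ) : ℝ :=
  (s.factorial * (n - 1 - s).factorial : ℝ) / n.factorial

/-- The Shapley value of `w`: the average decrease of `g` when `w` is added to the set of elements
of `B` that come before `w` in a uniformly random order. -/
noncomputable def shapley (g : Finset V → ℝ) (B : Finset V) (w : V) : ℝ :=
  ∑ S ∈ (B.erase w).powerset, shapleyWeight B.card S.card * (g S - g (insert w S))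

lemma shapleyWeight_nonneg (n s : ℕ) : 0 ≤ shapleyWeight n s := by
  unfold shapleyWeight; positivity

lemma shapley_mono {g g' : Finset V → ℝ} {B : Finset V} {w : V}
    (h : ∀ S, g S - g (insert w S) ≤ g' S - g' (insert w S)) :
    shapley g B w ≤ shapley g' B w :=
  Finset.sum_le_sum fun S _ => mul_le_mul_of_nonneg_left (h S) (shapleyWeight_nonneg _ _)

lemma shapley_nonneg {g : Finset V → ℝ} (h : ∀ S w, g (insert w S) ≤ g S) (B : Finset V) (w : V) :
    0 ≤ shapley g B w :=
  Finset.sum_nonneg fun S _ => mul_nonneg (shapleyWeight_nonneg _ _) (sub_nonneg.2 (h S w))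

lemma shapley_eq_zero {g : Finset V → ℝ} {w : V} (h : ∀ S, g (insert w S) = g S) (B : Finset V) :
    shapley g B w = 0 :=
  Finset.sum_eq_zero fun S _ => by rw [h]; simp

/-- The Shapley values distribute the total decrease. -/
lemma sum_shapley (g : Finset V → ℝ) (B : Finset V) :
    ∑ w ∈ B, shapley g B w = g ∅ - g B := by
  set n := B.card with hn
  have h1 : ∑ w ∈ B, ∑ S ∈ (B.erase w).powerset, shapleyWeight n S.card * g S =
      ∑ S ∈ B.powerset, ((n - S.card : ℕ) : ℝ) * shapleyWeight n S.card * g S := by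
    have : ∀ S ∈ B.powerset, ((n - S.card : ℕ) : ℝ) * shapleyWeight n S.card * g S =
        ∑ w ∈ B \ S, shapleyWeight n S.card * g S := fun S hS => by
      rw [Finset.sum_const, Finset.card_sdiff_of_subset (Finset.mem_powerset.1 hS), nsmul_eq_mul,
        mul_assoc]
    rw [Finset.sum_congr rfl this]
    refine Finset.sum_comm' fun w S => ?_
    simp only [Finset.mem_powerset, Finset.mem_sdiff, Finset.subset_erase]
    tauto
  have h2 : ∑ w ∈ B, ∑ S ∈ (B.erase w).powerset, shapleyWeight n S.card * g (insert w S) =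
      ∑ S ∈ B.powerset, (S.card : ℝ) * shapleyWeight n (S.card - 1) * g S := by
    have h3 : ∀ w ∈ B, ∑ S ∈ (B.erase w).powerset, shapleyWeight n S.card * g (insert w S) =
        ∑ S ∈ B.powerset with w ∈ S, shapleyWeight n (S.card - 1) * g S := fun w hw => by
      refine Finset.sum_bij' (fun S _ => insert w S) (fun S _ => S.erase w) ?_ ?_ ?_ ?_ ?_
      · intro S hS
        simp only [Finset.mem_powerset, Finset.subset_erase] at hS
        simp [Finset.insert_subset_iff, hw, hS.1]
      · intro S hS
        simp only [Finset.mem_filter, Finset.mem_powerset] at hS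
        exact Finset.mem_powerset.2 (Finset.erase_subset_erase _ hS.1)
      · intro S hS
        simp only [Finset.mem_powerset, Finset.subset_erase] at hS
        exact Finset.erase_insert hS.2
      · intro S hS
        exact Finset.insert_erase (Finset.mem_filter.1 hS).2
      · intro S hS
        simp only [Finset.mem_powerset, Finset.subset_erase] at hS
        rw [Finset.card_insert_of_notMem hS.2, Nat.add_sub_cancel]
    have : ∀ S ∈ B.powerset, (S.card : ℝ) * shapleyWeight n (S.card - 1) * g S =
        ∑ w ∈ S, shapleyWeight n (S.card - 1) * g S := fun S hS => by
      rw [Finset.sum_const, nsmul_eq_mul, mul_assoc]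
    rw [Finset.sum_congr rfl this, Finset.sum_congr rfl h3]
    refine Finset.sum_comm' fun w S => ?_
    simp only [Finset.mem_powerset, Finset.mem_filter]
    exact ⟨fun h => ⟨h.2.2, h.2.1⟩, fun h => ⟨h.2 h.1, h.2, h.1⟩⟩
  -- With `s = S.card`, both coefficients of `g S` equal `s! (n - s)! / n!`, except that the first
  -- vanishes at `s = n` and the second at `s = 0`. Only the empty set and `B` survive, and the
  -- truncated `s - 1` at `s = 0` is multiplied by `0`.
  have h4 : ∀ S ∈ B.powerset, ((n - S.card : ℕ) : ℝ) * shapleyWeight n S.card * g S -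
      (S.card : ℝ) * shapleyWeight n (S.card - 1) * g S =
      (if S = ∅ then g S else 0) - (if S = B then g S else 0) := fun S hS => by
    have hSB := Finset.mem_powerset.1 hS
    have hle : S.card ≤ n := Finset.card_le_card hSB
    have hB : S = B ↔ S.card = n :=
      ⟨fun h => by rw [h], fun h => Finset.eq_of_subset_of_card_le hSB h.ge⟩
    have h0 : S = ∅ ↔ S.card = 0 := Finset.card_eq_zero.symm
    simp only [h0, hB, ← sub_mul]
    have hfac : ∀ k : ℕ, (k.factorial : ℝ) ≠ 0 := fun k => by positivity
    have e1 : ((n - S.card : ℕ) : ℝ) * shapleyWeight n S.card =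
        if S.card = n then 0 else (S.card.factorial * (n - S.card).factorial : ℝ) / n.factorial := by
      split_ifs with h
      · simp [h]
      · obtain ⟨m, hm⟩ : ∃ m, n - S.card = m + 1 := ⟨n - S.card - 1, by omega⟩
        have : n - 1 - S.card = m := by omega
        rw [shapleyWeight, this, hm, Nat.factorial_succ]
        push_cast
        ring
    have e2 : (S.card : ℝ) * shapleyWeight n (S.card - 1) =
        if S.card = 0 then 0 else (S.card.factorial * (n - S.card).factorial : ℝ) / n.factorial := by
      split_ifs with h
      · simp [h]
      · obtain ⟨m, hm⟩ : ∃ m, S.card = m + 1 := ⟨S.card - 1, by omega⟩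
        have : n - 1 - m = n - (m + 1) := by omega
        rw [shapleyWeight, hm, Nat.add_sub_cancel, this, Nat.factorial_succ]
        push_cast
        ring
    rw [e1, e2]
    split_ifs with ha hb hb
    · simp
    · simp [ha, hfac]
    · simp [hb, hfac]
    · simp
  simp only [shapley, mul_sub, Finset.sum_sub_distrib]
  rw [h1, h2, ← Finset.sum_sub_distrib, Finset.sum_congr rfl h4, Finset.sum_sub_distrib]
  simp

/-- An additional element comes either after or before the given one; these two cases are the two
summands. -/
lemma shapleyWeight_succ {n s : ℕ} (h : s < n) :
    shapleyWeight (n + 1) s + shapleyWeight (n + 1) (s + 1) = shapleyWeight n s := by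
  obtain ⟨m, rfl⟩ : ∃ m, n = s + 1 + m := ⟨n - (s + 1), by omega⟩
  have h1 : s + 1 + m + 1 - 1 - s = m + 1 := by omega
  have h2 : s + 1 + m + 1 - 1 - (s + 1) = m := by omega
  have h3 : s + 1 + m - 1 - s = m := by omega
  have h4 : ((s + 1 + m).factorial : ℝ) ≠ 0 := by positivity
  simp only [shapleyWeight, h1, h2, h3, Nat.factorial_succ (s + 1 + m), Nat.factorial_succ s,
    Nat.factorial_succ m]
  push_cast
  field_simp
  ring

/-- Elements that never change `g` can be left out. -/
lemma shapley_insert {g : Finset V → ℝ} {x w : V} (hx : ∀ S, g (insert x S) = g S) {B : Finset V}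
    (hxB : x ∉ B) (hw : w ∈ B) : shapley g (insert x B) w = shapley g B w := by
  have hwx : x ≠ w := fun h => hxB (h ▸ hw)
  have hx' : x ∉ B.erase w := fun h => hxB (Finset.mem_of_mem_erase h)
  rw [shapley, shapley, Finset.erase_insert_of_ne hwx, Finset.sum_powerset_insert hx',
    Finset.card_insert_of_notMem hxB, ← Finset.sum_add_distrib]
  refine Finset.sum_congr rfl fun S hS => ?_
  have hS' := Finset.mem_powerset.1 hS
  have hlt : S.card < B.card :=
    (Finset.card_le_card hS').trans_lt (Finset.card_erase_lt_of_mem hw)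
  rw [Finset.insert_comm, hx, hx, Finset.card_insert_of_notMem fun h => hx' (hS' h), ← add_mul,
    shapleyWeight_succ hlt]

/-- Allows events with different sets of relevant labels to be compared in one common random order.
-/
lemma shapley_eq_of_subset {g : Finset V → ℝ} {B W : Finset V} (hBW : B ⊆ W)
    (hg : ∀ x ∉ B, ∀ S, g (insert x S) = g S) {w : V} (hw : w ∈ B) :
    shapley g W w = shapley g B w := by
  obtain ⟨D, rfl⟩ : ∃ D, W = D ∪ B := ⟨W, by simp [hBW]⟩
  clear hBW
  induction D using Finset.induction_on with
  | empty => simp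
  | insert x D hxD ih =>
    by_cases hx : x ∈ B
    · rwa [Finset.insert_union, Finset.insert_eq_of_mem (Finset.mem_union_right _ hx)]
    · rw [Finset.insert_union, shapley_insert (hg x hx) (by simp [hxD, hx])
        (Finset.mem_union_right _ hw), ih]

lemma shapley_map {g g' : Finset V → ℝ} (γ : V ≃ V)
    (h : ∀ S : Finset V, g' (S.map γ.toEmbedding) = g S)
    (B : Finset V) (w : V) : shapley g' (B.map γ.toEmbedding) (γ w) = shapley g B w := by
  have he : (B.map γ.toEmbedding).erase (γ w) = (B.erase w).map γ.toEmbedding :=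
    (Finset.map_erase γ.toEmbedding B w).symm
  rw [shapley, shapley, he, Finset.card_map]
  symm
  refine Finset.sum_bij' (fun S _ => S.map γ.toEmbedding) (fun S _ => S.map γ.symm.toEmbedding)
    ?_ ?_ ?_ ?_ ?_
  · intro S hS
    rw [Finset.mem_powerset] at hS ⊢
    exact Finset.map_subset_map.2 hS
  · intro S hS
    rw [Finset.mem_powerset] at hS ⊢
    intro x hx
    obtain ⟨y, hy, rfl⟩ := Finset.mem_map.1 hx
    obtain ⟨z, hz, rfl⟩ := Finset.mem_map.1 (hS hy)
    simpa using hz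
  · intro S hS
    simp [Finset.map_map]
  · intro S hS
    simp [Finset.map_map]
  · intro S hS
    have : insert (γ w) (S.map γ.toEmbedding) = (insert w S).map γ.toEmbedding :=
      (Finset.map_insert γ.toEmbedding w S).symm
    rw [this, h, h, Finset.card_map]

end Shapley

/-! ### Functions of finitely many labels from a finite alphabet. -/

section FiniteAlphabet

variable {V K : Type*}

lemma DependsOn.exists_eq_comp_restrict [Nonempty K] {β : Type*} {B : Finset V}
    {h : (V → K) → β} (hB : DependsOn h B) :
    ∃ h' : (B → K) → β, h = h' ∘ B.restrict := by
  have : Nonempty β := ⟨h fun _ => Classical.arbitrary K⟩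
  obtain ⟨h', hh⟩ := (dependsOn_iff_exists_comp (s := (B : Set V))).1 hB
  exact ⟨h', hh⟩

lemma DependsOn.comp_update [DecidableEq V] {β : Type*} {B : Finset V} {h : (V → K) → β}
    (hB : DependsOn h B) (w : V) (k : K) : DependsOn (fun z => h (Function.update z w k)) B := by
  intro z z' hz
  refine hB fun i hi => ?_
  by_cases hiw : i = w
  · subst hiw; simp
  · simp [hiw, hz i hi]

lemma DependsOn.comp_piecewise [DecidableEq V] {β : Type*} {B : Finset V} {h : (V → K) → β}
    (hB : DependsOn h B) (S : Finset V) (z : V → K) :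
    DependsOn (fun y => h (S.piecewise z y)) B := by
  intro y y' hy
  exact hB fun i hi => by simp [Finset.piecewise, hy i hi]

variable [MeasurableSpace K] [Finite K] [MeasurableSingletonClass K]

lemma DependsOn.measurable [Nonempty K] {β : Type*} [MeasurableSpace β] {B : Finset V}
    {h : (V → K) → β} (hB : DependsOn h B) : Measurable h := by
  obtain ⟨h', rfl⟩ := hB.exists_eq_comp_restrict
  exact (measurable_of_finite h').comp (Finset.measurable_restrict B)

lemma DependsOn.measurableSet [Nonempty K] {B : Finset V} {A : Set (V → K)}
    (hB : DependsOn (· ∈ A) B) : MeasurableSet A :=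
  measurableSet_setOfPred.2 hB.measurable

/-- Such a function takes finitely many values. This is why finite alphabets are used: no regularity
of `f` or `F` is needed to integrate. -/
lemma DependsOn.integrable [Nonempty K] {μ : Measure (V → K)} [IsFiniteMeasure μ]
    {B : Finset V} {h : (V → K) → ℝ} (hB : DependsOn h B) : Integrable h μ := by
  obtain ⟨h', rfl⟩ := hB.exists_eq_comp_restrict
  exact (Integrable.of_finite (f := h')).comp_measurable (Finset.measurable_restrict B)

end FiniteAlphabet

/-! ### Product measures: permuting and resampling coordinates. -/

section InfinitePi

variable {V K : Type*} [MeasurableSpace K] (ν : Measure K) [IsProbabilityMeasure ν]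

/-- A product of identical laws is invariant under permutations of the index set. -/
lemma measurePreserving_infinitePi_comp (γ : V ≃ V) :
    MeasurePreserving (fun z : V → K => z ∘ γ) (Measure.infinitePi fun _ : V => ν)
      (Measure.infinitePi fun _ : V => ν) := by
  have h := Measure.infinitePi_map_piCongrLeft (μ := fun _ : V => ν) γ.symm
  refine ⟨measurable_pi_lambda _ fun v => measurable_pi_apply _, ?_⟩
  convert h using 2
  ext z v
  obtain ⟨w, rfl⟩ := γ.symm.surjective v
  rw [MeasurableEquiv.piCongrLeft_apply_apply]
  simp

variable [DecidableEq V]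

/-- Resampling one coordinate preserves the law. -/
lemma measurePreserving_update (w : V) :
    MeasurePreserving (fun p : (V → K) × K => Function.update p.1 w p.2)
      ((Measure.infinitePi fun _ : V => ν).prod ν) (Measure.infinitePi fun _ : V => ν) := by
  have hm : Measurable fun p : (V → K) × K => Function.update p.1 w p.2 := by
    refine measurable_pi_lambda _ fun v => ?_
    by_cases h : v = w
    · subst h; simpa using measurable_snd
    · simpa [h] using! (measurable_pi_apply v).comp measurable_fst
  refine ⟨hm, Measure.eq_infinitePi _ fun s t ht => ?_⟩
  rw [Measure.map_apply hm (MeasurableSet.pi s.countable_toSet fun i _ => ht i)]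
  by_cases hw : w ∈ s
  · have : (fun p : (V → K) × K => Function.update p.1 w p.2) ⁻¹' Set.pi s t =
        (Set.pi (s.erase w : Finset V) t) ×ˢ t w := by
      ext ⟨z, k⟩
      simp only [Set.mem_preimage, Set.mem_pi, Set.mem_prod, Finset.mem_coe, Finset.mem_erase]
      constructor
      · refine fun h => ⟨fun i hi => ?_, ?_⟩
        · simpa [hi.1] using h i hi.2
        · simpa using h w hw
      · rintro ⟨h1, h2⟩ i hi
        by_cases hiw : i = w
        · subst hiw; simpa using h2
        · simpa [hiw] using h1 i ⟨hiw, hi⟩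
    rw [this, Measure.prod_prod, Measure.infinitePi_pi _ fun i _ => ht i,
      Finset.prod_erase_mul _ _ hw]
  · have : (fun p : (V → K) × K => Function.update p.1 w p.2) ⁻¹' Set.pi s t =
        (Set.pi s t) ×ˢ Set.univ := by
      ext ⟨z, k⟩
      simp only [Set.mem_preimage, Set.mem_pi, Set.mem_prod, Finset.mem_coe, Set.mem_univ,
        and_true]
      refine forall₂_congr fun i hi => ?_
      have hiw : i ≠ w := fun h => hw (h ▸ hi)
      simp [hiw]
    rw [this, Measure.prod_prod, Measure.infinitePi_pi _ fun i _ => ht i]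
    simp

variable [Fintype K] [MeasurableSingletonClass K]

lemma integral_update {B : Finset V} {h : (V → K) → ℝ} (hB : DependsOn h B) (w : V) :
    ∫ z, ∑ k, ν.real {k} * h (Function.update z w k) ∂(Measure.infinitePi fun _ : V => ν) =
      ∫ z, h z ∂(Measure.infinitePi fun _ : V => ν) := by
  have : Nonempty K := ν.nonempty_of_neZero
  have hp := measurePreserving_update (V := V) ν w
  have hi : Integrable h (Measure.infinitePi fun _ : V => ν) := hB.integrable
  have h1 : ∫ z, h z ∂(Measure.infinitePi fun _ : V => ν) =
      ∫ p : (V → K) × K, h (Function.update p.1 w p.2)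
        ∂(Measure.infinitePi fun _ : V => ν).prod ν := by
    conv_lhs => rw [← hp.map_eq]
    exact integral_map hp.measurable.aemeasurable (by rw [hp.map_eq]; exact hi.1)
  have h2 : Integrable (fun p : (V → K) × K => h (Function.update p.1 w p.2))
      ((Measure.infinitePi fun _ : V => ν).prod ν) := hp.integrable_comp_of_integrable hi
  rw [h1, integral_prod _ h2]
  refine integral_congr_ae (Filter.Eventually.of_forall fun z => ?_)
  simp only
  rw [integral_fintype (Integrable.of_finite)]
  simp

end InfinitePi

/-! ### Conditional probabilities given the revealed labels. -/

section Reveal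

variable {V K : Type*} [DecidableEq V] [MeasurableSpace K] (ν : Measure K)

/-- The conditional probability of `A` given the labels in `S`, when labels are i.i.d. -/
noncomputable def revealedProb (A : Set (V → K)) (S : Finset V) (z : V → K) : ℝ :=
  (Measure.infinitePi fun _ : V => ν).real {z' | S.piecewise z z' ∈ A}

variable {ν} {A : Set (V → K)} {B : Finset V}

lemma dependsOn_revealedProb (A : Set (V → K)) (S : Finset V) :
    DependsOn (revealedProb ν A S) S := by
  intro z z' h
  have : ∀ y, S.piecewise z y = S.piecewise z' y := fun y =>
    Finset.piecewise_congr _ h fun _ _ => rfl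
  simp [revealedProb, this]

lemma revealedProb_nonneg (A : Set (V → K)) (S : Finset V) (z : V → K) :
    0 ≤ revealedProb ν A S z := measureReal_nonneg

lemma revealedProb_empty (z : V → K) :
    revealedProb ν A ∅ z = (Measure.infinitePi fun _ : V => ν).real A := by
  simp [revealedProb]

lemma revealedProb_insert_of_notMem (hA : DependsOn (· ∈ A) B) {w : V} (hw : w ∉ B)
    (S : Finset V) : revealedProb ν A (insert w S) = revealedProb ν A S := by
  ext z
  unfold revealedProb
  congr 1
  ext y
  refine Iff.of_eq (hA fun i hi => ?_)
  have : i ≠ w := fun h => hw (h ▸ hi)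
  simp [Finset.piecewise, this]

lemma revealedProb_map (γ : V ≃ V) (S : Finset V) (z : V → K) [IsProbabilityMeasure ν]
    (hA : MeasurableSet A) :
    revealedProb ν {z | z ∘ γ ∈ A} (S.map γ.toEmbedding) z = revealedProb ν A S (z ∘ γ) := by
  unfold revealedProb
  have hp := measurePreserving_infinitePi_comp (V := V) ν γ
  have hm : MeasurableSet {y | S.piecewise (z ∘ γ) y ∈ A} := by
    refine hA.preimage (measurable_pi_lambda _ fun v => ?_)
    by_cases hv : v ∈ S
    · simp [hv]
    · simpa [hv] using measurable_pi_apply v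
  have := hp.measureReal_preimage hm.nullMeasurableSet
  rw [← this]
  congr 1
  ext y
  simp only [Set.mem_ofPred_eq, Set.mem_preimage]
  have : (S.map γ.toEmbedding).piecewise z y ∘ γ = S.piecewise (z ∘ γ) (y ∘ γ) := by
    ext v
    simp [Finset.piecewise]
  rw [this]

variable [IsProbabilityMeasure ν]

lemma revealedProb_of_subset (hA : DependsOn (· ∈ A) B) {S : Finset V} (hS : B ⊆ S) (z : V → K) :
    revealedProb ν A S z = A.indicator 1 z := by
  have : ∀ y, S.piecewise z y ∈ A ↔ z ∈ A := fun y => by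
    refine Iff.of_eq (hA fun i hi => ?_)
    simp [hS hi]
  by_cases hz : z ∈ A <;> simp [revealedProb, this, hz]

lemma revealedProb_le_one (A : Set (V → K)) (S : Finset V) (z : V → K) :
    revealedProb ν A S z ≤ 1 := measureReal_le_one

variable [Fintype K] [MeasurableSingletonClass K]

lemma revealedProb_add_le_one {A' : Set (V → K)} {B' : Finset V}
    (hA' : DependsOn (· ∈ A') B') (hd : Disjoint A A') (S : Finset V) (z : V → K) :
    revealedProb ν A S z + revealedProb ν A' S z ≤ 1 := by
  have : Nonempty K := ν.nonempty_of_neZero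
  have h1 : MeasurableSet ((fun y => S.piecewise z y) ⁻¹' A') :=
    DependsOn.measurableSet (B := B') (hA'.comp_piecewise S z)
  change Measure.real _ ((fun y => S.piecewise z y) ⁻¹' A) +
    Measure.real _ ((fun y => S.piecewise z y) ⁻¹' A') ≤ 1
  rw [← measureReal_union (hd.preimage fun y => S.piecewise z y) h1]
  exact measureReal_le_one

/-- Tower property of `revealedProb` when one more label is revealed. -/
lemma revealedProb_eq_sum (hA : DependsOn (· ∈ A) B) {S : Finset V} {w : V} (hw : w ∉ S)
    (z : V → K) :
    revealedProb ν A S z =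
      ∑ k, ν.real {k} * revealedProb ν A (insert w S) (Function.update z w k) := by
  have : Nonempty K := ν.nonempty_of_neZero
  have hint : ∀ (T : Finset V) (z : V → K), revealedProb ν A T z =
      ∫ y, A.indicator 1 (T.piecewise z y) ∂(Measure.infinitePi fun _ : V => ν) := by
    intro T z
    have hm : MeasurableSet ((fun y => T.piecewise z y) ⁻¹' A) :=
      DependsOn.measurableSet (B := B) (hA.comp_piecewise T z)
    have := integral_indicator_one (μ := Measure.infinitePi fun _ : V => ν) hm
    exact this.symm
  have hdep : DependsOn (A.indicator (1 : (V → K) → ℝ)) B := by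
    intro y y' h
    have := hA h
    simp only [eq_iff_iff] at this
    by_cases hy : y' ∈ A
    · simp [hy, this.2 hy]
    · simp [hy, mt this.1 hy]
  rw [hint, ← integral_update ν (hdep.comp_piecewise S z) w, integral_finsetSum]
  · refine Finset.sum_congr rfl fun k _ => ?_
    rw [integral_const_mul, hint]
    congr 2
    ext y
    congr 1
    ext i
    by_cases hi : i = w
    · subst hi; simp [Finset.piecewise, hw]
    · simp [Finset.piecewise, hi]
  · intro k _
    exact (((hdep.comp_piecewise S z).comp_update w k).integrable).const_mul _

/-- Jensen's inequality for the resampling of one coordinate. -/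
lemma integral_concave_update_le {E : Type*} [AddCommGroup E] [Module ℝ E] {C : Set E} {g : E → ℝ}
    (hg : ConcaveOn ℝ C g) {p p' : (V → K) → E} {S S' : Finset V} (hp : DependsOn p S)
    (hp' : DependsOn p' S') (hC : ∀ z, p' z ∈ C) (w : V)
    (h : ∀ z, p z = ∑ k, ν.real {k} • p' (Function.update z w k)) :
    ∫ z, g (p' z) ∂(Measure.infinitePi fun _ : V => ν) ≤
      ∫ z, g (p z) ∂(Measure.infinitePi fun _ : V => ν) := by
  have : Nonempty K := ν.nonempty_of_neZero
  have h1 : DependsOn (fun z => g (p z)) S := fun z z' hz => congrArg g (hp hz)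
  have h2 : DependsOn (fun z => g (p' z)) S' := fun z z' hz => congrArg g (hp' hz)
  rw [← integral_update ν h2 w]
  refine integral_mono (integrable_finsetSum _ fun k _ =>
    ((h2.comp_update w k).integrable).const_mul _) h1.integrable fun z => ?_
  simp only
  rw [h z]
  refine hg.le_map_sum (fun _ _ => measureReal_nonneg) ?_ fun _ _ => hC _
  simp

end Reveal

/-! ### The edge inequality for finite-range events. -/

section LocalInequality

variable {V K : Type*} [DecidableEq V] [MeasurableSpace K] (ν : Measure K)

/-- The average of `f` at the conditional probability of `A` given the labels in `S`. -/
noncomputable def averageAt (f : ℝ → ℝ) (A : Set (V → K)) (S : Finset V) : ℝ :=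
  ∫ z, f (revealedProb ν A S z) ∂(Measure.infinitePi fun _ : V => ν)

/-- The average of `F` at the conditional probabilities of `A` and `A'` given the labels in `S`. -/
noncomputable def averageAtPair (F : ℝ × ℝ → ℝ) (A A' : Set (V → K)) (S : Finset V) : ℝ :=
  ∫ z, F (revealedProb ν A S z, revealedProb ν A' S z) ∂(Measure.infinitePi fun _ : V => ν)

variable {ν} {f : ℝ → ℝ} {F : ℝ × ℝ → ℝ} {A A' : Set (V → K)} {B B' : Finset V}

lemma dependsOn_revealedProb_pair (A A' : Set (V → K)) (S : Finset V) :
    DependsOn (fun z => (revealedProb ν A S z, revealedProb ν A' S z)) S := fun _ _ h =>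
  Prod.ext (dependsOn_revealedProb A S h) (dependsOn_revealedProb A' S h)

lemma averageAt_insert_of_notMem (hA : DependsOn (· ∈ A) B) {w : V} (hw : w ∉ B)
    (S : Finset V) : averageAt ν f A (insert w S) = averageAt ν f A S := by
  rw [averageAt, revealedProb_insert_of_notMem hA hw, averageAt]

variable [IsProbabilityMeasure ν]

lemma averageAt_empty :
    averageAt ν f A ∅ = f ((Measure.infinitePi fun _ : V => ν).real A) := by
  simp [averageAt, revealedProb_empty]

lemma averageAtPair_empty :
    averageAtPair ν F A A' ∅ = F ((Measure.infinitePi fun _ : V => ν).real A,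
      (Measure.infinitePi fun _ : V => ν).real A') := by
  simp [averageAtPair, revealedProb_empty]

lemma averageAt_of_subset (hf0 : f 0 = 0) (hf1 : f 1 = 0) (hA : DependsOn (· ∈ A) B)
    {S : Finset V} (hS : B ⊆ S) : averageAt ν f A S = 0 := by
  refine integral_eq_zero_of_ae (Filter.Eventually.of_forall fun z => ?_)
  simp only [revealedProb_of_subset hA hS]
  by_cases hz : z ∈ A <;> simp [hz, hf0, hf1]

lemma averageAtPair_of_subset (hF00 : F (0, 0) = 0) (hF01 : F (0, 1) = 0) (hF10 : F (1, 0) = 0)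
    (hA : DependsOn (· ∈ A) B) (hA' : DependsOn (· ∈ A') B') (hd : Disjoint A A')
    {S : Finset V} (hS : B ⊆ S) (hS' : B' ⊆ S) : averageAtPair ν F A A' S = 0 := by
  refine integral_eq_zero_of_ae (Filter.Eventually.of_forall fun z => ?_)
  simp only [revealedProb_of_subset hA hS, revealedProb_of_subset hA' hS']
  by_cases hz : z ∈ A
  · have hz' : z ∉ A' := Set.disjoint_left.1 hd hz
    simp [hz, hz', hF10]
  · by_cases hz' : z ∈ A' <;> simp [hz, hz', hF00, hF01]

variable [Fintype K] [MeasurableSingletonClass K]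

lemma integrable_averageAt (f : ℝ → ℝ) (A : Set (V → K)) (S : Finset V) :
    Integrable (fun z => f (revealedProb ν A S z)) (Measure.infinitePi fun _ : V => ν) :=
  have : Nonempty K := ν.nonempty_of_neZero
  DependsOn.integrable (B := S) fun _ _ h => congrArg f (dependsOn_revealedProb A S h)

lemma integrable_averageAtPair (F : ℝ × ℝ → ℝ) (A A' : Set (V → K)) (S : Finset V) :
    Integrable (fun z => F (revealedProb ν A S z, revealedProb ν A' S z))
      (Measure.infinitePi fun _ : V => ν) :=
  have : Nonempty K := ν.nonempty_of_neZero
  DependsOn.integrable (B := S) fun _ _ h => congrArg F (dependsOn_revealedProb_pair A A' S h)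

lemma averageAt_insert_le (hf : ConcaveOn ℝ (Set.Icc 0 1) f) (hA : DependsOn (· ∈ A) B)
    (S : Finset V) (w : V) : averageAt ν f A (insert w S) ≤ averageAt ν f A S := by
  by_cases hw : w ∈ S
  · rw [Finset.insert_eq_of_mem hw]
  · exact integral_concave_update_le hf (dependsOn_revealedProb A S)
      (dependsOn_revealedProb A (insert w S))
      (fun z => ⟨revealedProb_nonneg _ _ _, revealedProb_le_one _ _ _⟩) w
      (revealedProb_eq_sum hA hw)

lemma averageAtPair_insert_le (hF : ConcaveOn ℝ triangleT F) (hA : DependsOn (· ∈ A) B)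
    (hA' : DependsOn (· ∈ A') B') (hd : Disjoint A A') (S : Finset V) (w : V) :
    averageAtPair ν F A A' (insert w S) ≤ averageAtPair ν F A A' S := by
  by_cases hw : w ∈ S
  · rw [Finset.insert_eq_of_mem hw]
  · refine integral_concave_update_le hF (dependsOn_revealedProb_pair A A' S)
      (dependsOn_revealedProb_pair A A' (insert w S))
      (fun z => ⟨revealedProb_nonneg _ _ _, revealedProb_nonneg _ _ _,
        revealedProb_add_le_one hA' hd _ _⟩) w fun z => ?_
    rw [revealedProb_eq_sum hA hw, revealedProb_eq_sum hA' hw]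
    simp [Prod.ext_iff, Prod.fst_sum, Prod.snd_sum]

/-- By Jensen's inequality, revealing a label can only lower the mean of the concave function `F p -
f p.1`. -/
lemma averageAt_sub_le_fst (hF : ConcaveOn ℝ triangleT fun p => F p - f p.1)
    (hA : DependsOn (· ∈ A) B) (hA' : DependsOn (· ∈ A') B') (hd : Disjoint A A')
    (S : Finset V) (w : V) :
    averageAt ν f A S - averageAt ν f A (insert w S) ≤
      averageAtPair ν F A A' S - averageAtPair ν F A A' (insert w S) := by
  have h := averageAtPair_insert_le (ν := ν) hF hA hA' hd S w
  have h1 : ∀ T, averageAtPair ν (fun p => F p - f p.1) A A' T =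
      averageAtPair ν F A A' T - averageAt ν f A T := fun T =>
    integral_sub (integrable_averageAtPair F A A' T) (integrable_averageAt f A T)
  rw [h1, h1] at h
  linarith

lemma averageAt_sub_le_snd (hF : ConcaveOn ℝ triangleT fun p => F p - f p.2)
    (hA : DependsOn (· ∈ A) B) (hA' : DependsOn (· ∈ A') B') (hd : Disjoint A A')
    (S : Finset V) (w : V) :
    averageAt ν f A' S - averageAt ν f A' (insert w S) ≤
      averageAtPair ν F A A' S - averageAtPair ν F A A' (insert w S) := by
  have h := averageAtPair_insert_le (ν := ν) hF hA hA' hd S w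
  have h1 : ∀ T, averageAtPair ν (fun p => F p - f p.2) A A' T =
      averageAtPair ν F A A' T - averageAt ν f A' T := fun T =>
    integral_sub (integrable_averageAtPair F A A' T) (integrable_averageAt f A' T)
  rw [h1, h1] at h
  linarith

lemma averageAt_map (γ : V ≃ V) (hA : MeasurableSet A) (S : Finset V) :
    averageAt ν f {z | z ∘ γ ∈ A} (S.map γ.toEmbedding) = averageAt ν f A S := by
  have hp := measurePreserving_infinitePi_comp (V := V) ν γ
  have hint := integrable_averageAt (ν := ν) f A S
  simp only [averageAt, revealedProb_map γ S _ hA]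
  have h := integral_map (f := fun z => f (revealedProb ν A S z)) hp.measurable.aemeasurable
    (by rw [hp.map_eq]; exact hint.1)
  rw [hp.map_eq] at h
  exact h.symm

/-- A finite-range form of the edge inequality: the edge from `o` to `γ o` is compared with the
revelations at its two endpoints. -/
lemma SimpleGraph.IsTree.two_mul_sub_le {G : SimpleGraph V} (hG : G.IsTree) {o : V} (γ : G ≃g G)
    (hγ : G.Adj o (γ o)) (hγγ : γ (γ o) = o)
    (hF00 : F (0, 0) = 0) (hF01 : F (0, 1) = 0) (hF10 : F (1, 0) = 0)
    (hFx : ConcaveOn ℝ triangleT (fun p => F p - f p.1))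
    (hFy : ConcaveOn ℝ triangleT (fun p => F p - f p.2)) (hf0 : f 0 = 0) (hf1 : f 1 = 0)
    (hA : DependsOn (· ∈ A) B) (hd : Disjoint A {z | z ∘ γ ∈ A}) {q : ℝ}
    (hq : (Measure.infinitePi fun _ : V => ν).real A = q) :
    2 * f q - 2 * ∑ w ∈ B with G.dist w (γ o) < G.dist w o, shapley (averageAt ν f A) B w ≤
      F (q, q) := by
  have : Nonempty K := ν.nonempty_of_neZero
  set A' : Set (V → K) := {z | z ∘ γ ∈ A} with hA'def
  set B' : Finset V := B.map γ.toEquiv.toEmbedding with hB'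
  have hA' : DependsOn (· ∈ A') B' := fun z z' h => hA fun i hi =>
    h (γ i) (by simpa [hB'] using hi)
  have hq' : (Measure.infinitePi fun _ : V => ν).real A' = q := by
    rw [← hq]
    exact (measurePreserving_infinitePi_comp ν γ.toEquiv).measureReal_preimage
      hA.measurableSet.nullMeasurableSet
  set W := B ∪ B' with hW
  set a := averageAt ν f A with ha
  set a' := averageAt ν f A' with ha'
  set b := averageAtPair ν F A A' with hb
  have hsum : ∑ w ∈ W, shapley b W w = F (q, q) := by
    rw [sum_shapley, hb, averageAtPair_empty, averageAtPair_of_subset hF00 hF01 hF10 hA hA' hd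
      Finset.subset_union_left Finset.subset_union_right, hq, hq', sub_zero]
  have hsuma : ∑ w ∈ W, shapley a W w = f q := by
    rw [sum_shapley, ha, averageAt_empty, averageAt_of_subset hf0 hf1 hA
      Finset.subset_union_left, hq, sub_zero]
  have hsuma' : ∑ w ∈ W, shapley a' W w = f q := by
    rw [sum_shapley, ha', averageAt_empty, averageAt_of_subset hf0 hf1 hA'
      Finset.subset_union_right, hq', sub_zero]
  have hnull : ∀ x ∉ B, ∀ S, a (insert x S) = a S := fun x hx S =>
    averageAt_insert_of_notMem hA hx S
  have hnull' : ∀ x ∉ B', ∀ S, a' (insert x S) = a' S := fun x hx S =>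
    averageAt_insert_of_notMem hA' hx S
  have hle : ∀ w, shapley a W w ≤ shapley b W w := fun w =>
    shapley_mono fun S => averageAt_sub_le_fst hFx hA hA' hd S w
  have hle' : ∀ w, shapley a' W w ≤ shapley b W w := fun w =>
    shapley_mono fun S => averageAt_sub_le_snd hFy hA hA' hd S w
  have h1 : ∑ w ∈ W, (if G.dist w (γ o) < G.dist w o then shapley a W w else 0) =
      ∑ w ∈ B with G.dist w (γ o) < G.dist w o, shapley a B w := by
    rw [Finset.sum_filter, ← Finset.sum_subset (Finset.subset_union_left : B ⊆ W)]
    · exact Finset.sum_congr rfl fun w hw => by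
        rw [shapley_eq_of_subset Finset.subset_union_left hnull hw]
    · intro w _ hw
      rw [shapley_eq_zero (hnull w hw), ite_self]
  -- No vertex of a tree is equidistant from the ends of an edge, so `γ` exchanges the two sides
  -- exactly.
  have hdist : ∀ w, G.dist (γ w) (γ o) < G.dist (γ w) o ↔ ¬ G.dist w (γ o) < G.dist w o := by
    intro w
    have e1 := Iso.dist_map hG.connected γ w o
    have e2 := Iso.dist_map hG.connected γ w (γ o)
    rw [hγγ] at e2
    have := hG.dist_ne_of_adj w hγ
    omega
  have h2 : ∑ w ∈ W, (if G.dist w (γ o) < G.dist w o then 0 else shapley a' W w) =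
      ∑ w ∈ B with G.dist w (γ o) < G.dist w o, shapley a B w := by
    rw [Finset.sum_filter, ← Finset.sum_subset (Finset.subset_union_right : B' ⊆ W)]
    · rw [hB', Finset.sum_map]
      refine Finset.sum_congr rfl fun w hw => ?_
      have hmem : γ w ∈ B' := Finset.mem_map_of_mem γ.toEquiv.toEmbedding hw
      have e : shapley a' W (γ w) = shapley a B w := by
        rw [shapley_eq_of_subset Finset.subset_union_right hnull' hmem]
        exact shapley_map γ.toEquiv (fun S => averageAt_map γ.toEquiv hA.measurableSet S) B w
      change (if G.dist (γ w) (γ o) < G.dist (γ w) o then 0 else shapley a' W (γ w)) = _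
      rw [e]
      by_cases h : G.dist w (γ o) < G.dist w o
      · rw [if_neg (by rw [hdist]; exact not_not.2 h), if_pos h]
      · rw [if_pos ((hdist w).2 h), if_neg h]
    · intro w _ hw
      rw [shapley_eq_zero (hnull' w hw), ite_self]
  -- Termwise, what remains on the left is the share of `w` for its nearer endpoint: `a'` on the
  -- side of `γ o`, `a` on the side of `o`.
  have h3 : ∑ w ∈ W, shapley a W w + ∑ w ∈ W, shapley a' W w -
      ∑ w ∈ W, (if G.dist w (γ o) < G.dist w o then shapley a W w else 0) -
      ∑ w ∈ W, (if G.dist w (γ o) < G.dist w o then 0 else shapley a' W w) ≤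
      ∑ w ∈ W, shapley b W w := by
    rw [← Finset.sum_add_distrib, ← Finset.sum_sub_distrib, ← Finset.sum_sub_distrib]
    refine Finset.sum_le_sum fun w _ => ?_
    have := hle w
    have := hle' w
    split_ifs <;> linarith
  rw [h1, h2, hsum, hsuma, hsuma'] at h3
  linarith

/-- The edge inequality for finite-range processes with finitely many label values. -/
theorem SimpleGraph.IsTree.edge_inequality_of_dependsOn {G : SimpleGraph V} [G.LocallyFinite]
    (hG : G.IsTree) {d : ℕ} (hd : 1 ≤ d) {o : V} (hdeg : G.degree o = d) (γ : V → G ≃g G)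
    (hγ : ∀ v, G.Adj o v → γ v o = v ∧ γ v v = o)
    (hf : ConcaveOn ℝ (Set.Icc 0 1) f) (hf0 : f 0 = 0) (hf1 : f 1 = 0)
    (hF00 : F (0, 0) = 0) (hF01 : F (0, 1) = 0) (hF10 : F (1, 0) = 0)
    (hFx : ConcaveOn ℝ triangleT (fun p => F p - f p.1))
    (hFy : ConcaveOn ℝ triangleT (fun p => F p - f p.2))
    (hA : DependsOn (· ∈ A) B) (hdisj : ∀ v, G.Adj o v → Disjoint A {z | z ∘ γ v ∈ A}) {q : ℝ}
    (hq : (Measure.infinitePi fun _ : V => ν).real A = q) :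
    2 * ((d : ℝ) - 1) / d * f q ≤ F (q, q) := by
  set a := averageAt ν f A with ha
  have h1 : ∀ v ∈ G.neighborFinset o,
      2 * f q - 2 * ∑ w ∈ B with G.dist w v < G.dist w o, shapley a B w ≤ F (q, q) := by
    intro v hv
    have hv' : G.Adj o v := (G.mem_neighborFinset o v).1 hv
    obtain ⟨e1, e2⟩ := hγ v hv'
    have := hG.two_mul_sub_le (γ v) (by rwa [e1]) (by rw [e1, e2]) hF00 hF01 hF10 hFx hFy hf0 hf1
      hA (hdisj v hv') hq
    rwa [e1] at this
  have hnonneg : ∀ w, 0 ≤ shapley a B w := fun w =>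
    shapley_nonneg (fun S w => averageAt_insert_le hf hA S w) B w
  have h2 : ∑ v ∈ G.neighborFinset o, ∑ w ∈ B with G.dist w v < G.dist w o, shapley a B w ≤
      f q := by
    have e : f q = ∑ w ∈ B, shapley a B w := by
      rw [sum_shapley, ha, averageAt_empty, averageAt_of_subset hf0 hf1 hA subset_rfl, hq, sub_zero]
    simp only [Finset.sum_filter]
    rw [e, Finset.sum_comm]
    refine Finset.sum_le_sum fun w _ => ?_
    rw [← Finset.sum_filter, Finset.sum_const, nsmul_eq_mul]
    -- Only the neighbour of `o` on the path to `w` is nearer to `w`.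
    have hcard : ((G.neighborFinset o).filter fun v => G.dist w v < G.dist w o).card ≤ 1 := by
      refine Finset.card_le_one.2 fun v hv v' hv' => ?_
      simp only [Finset.mem_filter, mem_neighborFinset] at hv hv'
      refine hG.eq_of_adj_of_dist_add_one hv.1.symm hv'.1.symm (a := w) ?_ ?_
      · rcases hG.dist_eq_dist_add_one_of_adj w hv.1 with h | h <;> omega
      · rcases hG.dist_eq_dist_add_one_of_adj w hv'.1 with h | h <;> omega
    have hcard' : (((G.neighborFinset o).filter fun v => G.dist w v < G.dist w o).card : ℝ) ≤ 1 :=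
      by exact_mod_cast hcard
    exact mul_le_of_le_one_left (hnonneg w) hcard'
  have h3 := Finset.sum_le_sum h1
  rw [Finset.sum_const, Finset.sum_sub_distrib, Finset.sum_const, card_neighborFinset_eq_degree,
    hdeg, ← Finset.mul_sum, nsmul_eq_mul, nsmul_eq_mul] at h3
  have hd0 : (0 : ℝ) < d := by exact_mod_cast hd
  rw [div_mul_eq_mul_div, div_le_iff₀ hd0]
  linarith

end LocalInequality

/-! ### Approximation of factors of IID by finite-range events. -/

section Approximation

/-- Events that depend on finitely many labels, and on each of them only through membership in
finitely many measurable sets. -/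
def finiteLabelEvents (V I : Type*) [MeasurableSpace I] : Set (Set (V → I)) :=
  {A | ∃ (𝒮 : Set (Set I)) (B : Finset V), 𝒮.Finite ∧ (∀ s ∈ 𝒮, MeasurableSet s) ∧
    ∀ z z', (∀ w ∈ B, ∀ s ∈ 𝒮, z w ∈ s ↔ z' w ∈ s) → (z ∈ A ↔ z' ∈ A)}

universe u

variable {V : Type*} {I : Type u} [MeasurableSpace I]

lemma isSetAlgebra_finiteLabelEvents : IsSetAlgebra (finiteLabelEvents V I) := by
  classical
  refine ⟨⟨∅, ∅, by simp⟩, ?_, ?_⟩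
  · rintro A ⟨𝒮, B, h1, h2, h3⟩
    exact ⟨𝒮, B, h1, h2, fun z z' h => not_congr (h3 z z' h)⟩
  · rintro A A' ⟨𝒮, B, h1, h2, h3⟩ ⟨𝒮', B', h1', h2', h3'⟩
    refine ⟨𝒮 ∪ 𝒮', B ∪ B', h1.union h1', fun s hs => hs.elim (h2 s) (h2' s), fun z z' h => ?_⟩
    exact or_congr
      (h3 z z' fun w hw s hs => h w (Finset.mem_union_left _ hw) s (Or.inl hs))
      (h3' z z' fun w hw s hs => h w (Finset.mem_union_right _ hw) s (Or.inr hs))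

/-- Events in `finiteLabelEvents` are the events that depend on finitely many labels after the
labels are replaced by labels from a finite alphabet. -/
lemma exists_finite_coding {A : Set (V → I)} (hA : A ∈ finiteLabelEvents V I) :
    ∃ (K : Type u) (_ : Fintype K) (_ : MeasurableSpace K) (_ : MeasurableSingletonClass K)
      (κ : I → K) (A' : Set (V → K)) (B : Finset V), Measurable κ ∧ DependsOn (· ∈ A') B ∧
        A = {z | κ ∘ z ∈ A'} := by
  classical
  obtain ⟨𝒮, B, h1, h2, h3⟩ := hA
  have : Finite 𝒮 := h1
  have : Fintype 𝒮 := Fintype.ofFinite 𝒮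
  let κ : I → (𝒮 → Bool) := fun x s => decide (x ∈ s.1)
  have hκ : ∀ x y, κ x = κ y ↔ ∀ s ∈ 𝒮, x ∈ s ↔ y ∈ s := fun x y => by
    simp [κ, funext_iff]
  refine ⟨𝒮 → Bool, inferInstance, inferInstance, inferInstance, κ,
    {k | ∃ z ∈ A, ∀ w ∈ B, κ (z w) = k w}, B, ?_, ?_, ?_⟩
  · exact measurable_pi_lambda _ fun s => measurable_to_bool (by
      simpa [κ, Set.preimage] using h2 s.1 s.2)
  · intro k k' h
    refine propext ⟨?_, ?_⟩
    · rintro ⟨z, hz, hk⟩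
      exact ⟨z, hz, fun w hw => (hk w hw).trans (h w hw)⟩
    · rintro ⟨z, hz, hk⟩
      exact ⟨z, hz, fun w hw => (hk w hw).trans (h w hw).symm⟩
  · ext z
    refine ⟨fun hz => ⟨z, hz, fun _ _ => rfl⟩, ?_⟩
    rintro ⟨z', hz', h⟩
    exact (h3 z' z fun w hw => (hκ _ _).1 (h w hw)).1 hz'

lemma measurableSet_of_mem_finiteLabelEvents [Nonempty I] {A : Set (V → I)}
    (hA : A ∈ finiteLabelEvents V I) : MeasurableSet A := by
  obtain ⟨K, _, _, _, κ, A', B, hκ, hA', rfl⟩ := exists_finite_coding hA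
  have : Nonempty K := ‹Nonempty I›.map κ
  exact hA'.measurableSet.preimage
    (measurable_pi_lambda _ fun v => hκ.comp (measurable_pi_apply v))

lemma generateFrom_finiteLabelEvents [Nonempty I] :
    (inferInstance : MeasurableSpace (V → I)) =
      MeasurableSpace.generateFrom (finiteLabelEvents V I) := by
  apply le_antisymm
  · refine iSup_le fun v => ?_
    rintro _ ⟨s, hs, rfl⟩
    refine MeasurableSpace.measurableSet_generateFrom ⟨{s}, {v}, by simp, by simpa using hs, ?_⟩
    intro z z' h
    exact h v (by simp) s rfl
  · exact MeasurableSpace.generateFrom_le fun A hA => measurableSet_of_mem_finiteLabelEvents hA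

/-- The set of all `q ∈ [0, 1/2]` which satisfy all edge inequalities for degree `d`. -/
def edgeInequalitySet (d : ℕ) : Set ℝ :=
  {q | q ∈ Set.Icc (0 : ℝ) (1 / 2) ∧ ∀ (f : ℝ → ℝ) (F : ℝ × ℝ → ℝ),
    ConcaveOn ℝ (Set.Icc 0 1) f → f 0 = 0 → f 1 = 0 →
    F (0, 0) = 0 → F (0, 1) = 0 → F (1, 0) = 0 →
    ConcaveOn ℝ triangleT (fun p => F p - f p.1) →
    ConcaveOn ℝ triangleT (fun p => F p - f p.2) → 2 * ((d : ℝ) - 1) / d * f q ≤ F (q, q)}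

open scoped symmDiff in
/-- Densities of factor-of-IID independent sets are limits of densities of finite-range ones, so
they are limits of numbers satisfying the edge inequalities. -/
theorem fiidIndepDensities_subset_closure {G : SimpleGraph V} [G.LocallyFinite] {d : ℕ}
    (hd : 1 ≤ d) (hG : G.IsTree) (hreg : G.IsRegularOfDegree d) :
    fiidIndepDensities G ⊆ closure (edgeInequalitySet d) := by
  classical
  rintro q ⟨_, ⟨Φ, hΦ, rfl⟩, hind, hq⟩
  obtain ⟨o⟩ := hG.connected.nonempty
  have hγ : ∀ v, ∃ γ : G ≃g G, G.Adj o v → γ o = v ∧ γ v = o := fun v => by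
    by_cases h : G.Adj o v
    · obtain ⟨γ, h1, h2⟩ := hG.exists_inversion hd hreg h
      exact ⟨γ, fun _ => ⟨h1, by rw [← h1, h2]⟩⟩
    · exact ⟨SimpleGraph.Iso.refl, fun h' => absurd h' h⟩
  choose γ hγ using hγ
  set μ := iidLaw V with hμ
  have hprob : IsProbabilityMeasure μ := by rw [hμ, iidLaw]; infer_instance
  have hmp : ∀ v, MeasurePreserving (fun z : V → unitInterval => z ∘ γ v) μ μ := fun v =>
    measurePreserving_infinitePi_comp volume (γ v).toEquiv
  set A : Set (V → unitInterval) := {z | Φ z o = true} with hAdef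
  have hAm : MeasurableSet A :=
    (measurableSet_singleton true).preimage ((measurable_pi_apply o).comp hΦ.measurable)
  have hqA : μ.real A = q := by
    rw [← hq o, map_measureReal_apply hΦ.measurable]
    · rfl
    · exact (measurableSet_singleton true).preimage (measurable_pi_apply o)
  have hnull : ∀ v, G.Adj o v → μ (A ∩ {z | z ∘ γ v ∈ A}) = 0 := by
    intro v hv
    have h := ae_of_ae_map hΦ.measurable.aemeasurable hind
    refine measure_mono_null (fun z hz => ?_) (ae_iff.1 h)
    simp only [not_forall]
    refine ⟨o, v, hv, not_not.2 ⟨hz.1, ?_⟩⟩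
    have h1 := congrFun (hΦ.equivariant (γ v) z) o
    rw [(hγ v hv).1] at h1
    rw [← h1]
    exact hz.2
  rw [Metric.mem_closure_iff]
  intro ε hε
  obtain ⟨A₁, hA₁, hAA₁⟩ := (Measure.MeasureDense.of_generateFrom_isSetAlgebra_finite
    (μ := μ) isSetAlgebra_finiteLabelEvents generateFrom_finiteLabelEvents).approx A hAm
    (measure_ne_top _ _) (ε / (d + 1)) (by positivity)
  have hA₁m := measurableSet_of_mem_finiteLabelEvents hA₁
  obtain ⟨K, _, _, _, κ, A', B, hκ, hA', rfl⟩ := exists_finite_coding hA₁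
  have hK : Nonempty K := ⟨κ 0⟩
  set ν : Measure K := (volume : Measure unitInterval).map κ with hν
  have hνp : IsProbabilityMeasure ν := Measure.isProbabilityMeasure_map hκ.aemeasurable
  have hmap : μ.map (fun z => κ ∘ z) = Measure.infinitePi fun _ : V => ν :=
    Measure.infinitePi_map_pi (μ := fun _ : V => (volume : Measure unitInterval)) fun _ => hκ
  -- Deleting the conflicts restores exact disjointness along each edge at `o`. Invariance of `A₀`
  -- under the stabilizer of `o` is not needed: the edge inequality uses only the chosen inversions
  -- `γ v`.
  set A₀ : Set (V → K) := {k | k ∈ A' ∧ ∀ v ∈ G.neighborFinset o, k ∘ γ v ∉ A'} with hA₀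
  set B₀ : Finset V := B ∪ (G.neighborFinset o).biUnion fun v => B.map (γ v).toEquiv.toEmbedding
  have hA₀d : DependsOn (· ∈ A₀) B₀ := by
    intro k k' h
    have h1 : k ∈ A' ↔ k' ∈ A' := Iff.of_eq (hA' fun i hi =>
      h i (Finset.mem_coe.2 (Finset.mem_union_left _ hi)))
    have h2 : ∀ v ∈ G.neighborFinset o, (k ∘ γ v ∉ A' ↔ k' ∘ γ v ∉ A') := fun v hv =>
      not_congr (Iff.of_eq (hA' fun i hi => h (γ v i) (Finset.mem_coe.2 (Finset.mem_union_right _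
        (Finset.mem_biUnion.2 ⟨v, hv, Finset.mem_map_of_mem (γ v).toEquiv.toEmbedding hi⟩)))))
    exact propext (and_congr h1 (forall₂_congr h2))
  have hdisj : ∀ v, G.Adj o v → Disjoint A₀ {k | k ∘ γ v ∈ A₀} := fun v hv =>
    Set.disjoint_left.2 fun k hk hk' => hk.2 v ((G.mem_neighborFinset o v).2 hv) hk'.1
  set q₀ := (Measure.infinitePi fun _ : V => ν).real A₀ with hq₀
  refine ⟨q₀, ⟨⟨measureReal_nonneg, ?_⟩, fun f F hf hf0 hf1 hF00 hF01 hF10 hFx hFy =>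
    hG.edge_inequality_of_dependsOn hd (hreg o) γ hγ hf hf0 hf1 hF00 hF01 hF10 hFx hFy hA₀d
      hdisj rfl⟩, ?_⟩
  · obtain ⟨v, hv⟩ : (G.neighborFinset o).Nonempty := by
      rw [← Finset.card_pos, G.card_neighborFinset_eq_degree, hreg o]
      exact hd
    have hv' := (G.mem_neighborFinset o v).1 hv
    have hmp' := measurePreserving_infinitePi_comp (V := V) ν (γ v).toEquiv
    have h1 : (Measure.infinitePi fun _ : V => ν).real {k | k ∘ γ v ∈ A₀} = q₀ :=
      hmp'.measureReal_preimage hA₀d.measurableSet.nullMeasurableSet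
    have h2 := measureReal_union (μ := Measure.infinitePi fun _ : V => ν) (hdisj v hv')
      (hmp'.measurable hA₀d.measurableSet)
    have h3 : (Measure.infinitePi fun _ : V => ν).real (A₀ ∪ {k | k ∘ γ v ∈ A₀}) ≤ 1 :=
      measureReal_le_one
    rw [h1] at h2
    linarith
  · set A₁ : Set (V → unitInterval) := {z | κ ∘ z ∈ A'} with hA₁def
    have hκm : Measurable fun z : V → unitInterval => κ ∘ z :=
      measurable_pi_lambda _ fun v => hκ.comp (measurable_pi_apply v)
    have hq₀' : μ.real {z | κ ∘ z ∈ A₀} = q₀ := by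
      rw [hq₀, ← hmap, map_measureReal_apply hκm hA₀d.measurableSet]
      rfl
    have hA₀m : MeasurableSet {z : V → unitInterval | κ ∘ z ∈ A₀} := hκm hA₀d.measurableSet
    have hδ : μ.real (A ∆ A₁) < ε / (d + 1) := by
      rw [measureReal_def]
      exact (ENNReal.toReal_lt_of_lt_ofReal hAA₁)
    -- A deletion at a point of `A` needs some `z ∘ γ v ∈ A₁`: either `z ∘ γ v` is in `A` too, a
    -- null event, or it lies in the approximation error. Hence at most `d + 1` copies of that
    -- error.
    have hsub : A ∆ {z | κ ∘ z ∈ A₀} ⊆ A ∆ A₁ ∪ ⋃ v ∈ G.neighborFinset o,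
        ((fun z : V → unitInterval => z ∘ γ v) ⁻¹' (A ∆ A₁) ∪ (A ∩ {z | z ∘ γ v ∈ A})) := by
      intro z hz
      by_cases h1 : z ∈ A ∆ A₁
      · exact Or.inl h1
      refine Or.inr ?_
      have hiff : z ∈ A ↔ z ∈ A₁ := by
        rw [Set.mem_symmDiff] at h1
        tauto
      rcases hz with ⟨hzA, hz0⟩ | ⟨hz0, hzA⟩
      · have : ¬ ∀ v ∈ G.neighborFinset o, (κ ∘ z) ∘ γ v ∉ A' := fun h =>
          hz0 ⟨hiff.1 hzA, h⟩
        push Not at this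
        obtain ⟨v, hv, hzv⟩ := this
        refine Set.mem_biUnion hv ?_
        by_cases h2 : z ∘ γ v ∈ A
        · exact Or.inr ⟨hzA, h2⟩
        · exact Or.inl (Or.inr ⟨hzv, h2⟩)
      · exact absurd (hiff.2 hz0.1) hzA
    have hbound : μ.real (A ∆ {z | κ ∘ z ∈ A₀}) ≤ (d + 1) * μ.real (A ∆ A₁) := by
      refine (measureReal_mono hsub).trans ((measureReal_union_le _ _).trans ?_)
      have h1 := measureReal_biUnion_finset_le (μ := μ) (G.neighborFinset o) fun v =>
        (fun z : V → unitInterval => z ∘ γ v) ⁻¹' (A ∆ A₁) ∪ (A ∩ {z | z ∘ γ v ∈ A})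
      have h2 : ∀ v ∈ G.neighborFinset o, μ.real
          ((fun z : V → unitInterval => z ∘ γ v) ⁻¹' (A ∆ A₁) ∪ (A ∩ {z | z ∘ γ v ∈ A})) ≤
          μ.real (A ∆ A₁) := fun v hv => by
        refine (measureReal_union_le _ _).trans ?_
        rw [(hmp v).measureReal_preimage (hAm.symmDiff hA₁m).nullMeasurableSet,
          measureReal_def μ (A ∩ _), hnull v ((G.mem_neighborFinset o v).1 hv)]
        simp
      have h3 := h1.trans (Finset.sum_le_sum h2)
      rw [Finset.sum_const, G.card_neighborFinset_eq_degree, hreg o, nsmul_eq_mul] at h3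
      linarith
    rw [Real.dist_eq, ← hqA, ← hq₀']
    refine (abs_measureReal_sub_le_measureReal_symmDiff hAm.nullMeasurableSet
      hA₀m.nullMeasurableSet).trans_lt (hbound.trans_lt ?_)
    rwa [lt_div_iff₀' (by positivity)] at hδ

end Approximation

/-! ### Passage to the limit. -/

section Closure

/-- One quadratic choice of `f` and `F` already keeps `q` away from `1/2`, where `(q, q)` would
reach the boundary of the triangle. -/
lemma edgeInequalitySet_le {d : ℕ} (hd : 3 ≤ d) {q : ℝ} (hq : q ∈ edgeInequalitySet d) :
    q ≤ 43 / 88 := by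
  obtain ⟨⟨hq0, hq1⟩, h⟩ := hq
  have hconv : Convex ℝ triangleT := by
    rintro ⟨x, y⟩ ⟨h1, h2, h3⟩ ⟨x', y'⟩ ⟨h1', h2', h3'⟩ a b ha hb hab
    refine ⟨?_, ?_, ?_⟩ <;> simp only [Prod.fst_add, Prod.snd_add, Prod.smul_fst, Prod.smul_snd,
      smul_eq_mul] at *
    · positivity
    · positivity
    · nlinarith [mul_le_mul_of_nonneg_left h3 ha, mul_le_mul_of_nonneg_left h3' hb]
  -- The coefficients make the quadratic parts of `F - f(x)` and `F - f(y)` equal to `-(3x/4 +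
  -- 5y/4)²` and `-(5x/4 + 3y/4)²`. On the diagonal `F` is `25q/8 - 5q²`; comparison with `4q(1 -
  -- q)/3` gives `43/88`.
  have h1 := h (fun x => x * (1 - x))
    (fun p => 25 / 16 * (p.1 * (1 - p.1)) + 25 / 16 * (p.2 * (1 - p.2)) - 15 / 8 * (p.1 * p.2))
    ⟨convex_Icc 0 1, fun x _ y _ a b ha hb hab => by
      obtain rfl : b = 1 - a := by linarith
      simp only [smul_eq_mul]
      nlinarith [mul_nonneg (mul_nonneg ha hb) (sq_nonneg (x - y))]⟩
    (by norm_num) (by norm_num) (by norm_num) (by norm_num) (by norm_num)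
    ⟨hconv, fun x _ y _ a b ha hb hab => by
      obtain rfl : b = 1 - a := by linarith
      simp only [smul_eq_mul, Prod.fst_add, Prod.snd_add, Prod.smul_fst, Prod.smul_snd]
      nlinarith [mul_nonneg (mul_nonneg ha hb)
        (sq_nonneg ((3 / 4 * x.1 + 5 / 4 * x.2) - (3 / 4 * y.1 + 5 / 4 * y.2)))]⟩
    ⟨hconv, fun x _ y _ a b ha hb hab => by
      obtain rfl : b = 1 - a := by linarith
      simp only [smul_eq_mul, Prod.fst_add, Prod.snd_add, Prod.smul_fst, Prod.smul_snd]
      nlinarith [mul_nonneg (mul_nonneg ha hb)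
        (sq_nonneg ((5 / 4 * x.1 + 3 / 4 * x.2) - (5 / 4 * y.1 + 3 / 4 * y.2)))]⟩
  simp only at h1
  have hd' : (3 : ℝ) ≤ d := by exact_mod_cast hd
  have h2 : (4 / 3 : ℝ) ≤ 2 * ((d : ℝ) - 1) / d := by
    rw [le_div_iff₀ (by linarith)]
    linarith
  have h3 : 4 / 3 * (q * (1 - q)) ≤ 2 * ((d : ℝ) - 1) / d * (q * (1 - q)) :=
    mul_le_mul_of_nonneg_right h2 (mul_nonneg hq0 (by linarith))
  by_contra hlt
  push Not at hlt
  nlinarith [mul_pos (show (0 : ℝ) < q by linarith) (sub_pos.2 hlt)]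

/-- The edge inequalities pass to limits, although the functions involved may be discontinuous at
the boundary of their domains. -/
theorem closure_edgeInequalitySet_subset {d : ℕ} (hd : 1 ≤ d) :
    closure (edgeInequalitySet d) ⊆ edgeInequalitySet d := by
  intro q hq
  have hIcc : q ∈ Set.Icc (0 : ℝ) (1 / 2) :=
    closure_minimal (fun x hx => hx.1) isClosed_Icc hq
  refine ⟨hIcc, fun f F hf hf0 hf1 hF00 hF01 hF10 hFx hFy => ?_⟩
  rcases hIcc.1.eq_or_lt with rfl | hq0
  · simp [hf0, hF00]
  rcases hIcc.2.eq_or_lt with hq1 | hq1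
  · have hd2 : d ≤ 2 := by
      by_contra hd3
      have : q ≤ 43 / 88 :=
        closure_minimal (fun x hx => edgeInequalitySet_le (by omega) hx) isClosed_Iic hq
      norm_num [hq1] at this
    -- For `d ≤ 2` no limit is needed at `1/2`: the midpoint of `(1, 0)` and `(0, 1)` gives `F (1/2,
    -- 1/2) ≥ f (1/2) ≥ 0`, and the factor `2 (d - 1) / d` is at most `1`.
    have h1 := hFx.2 (show ((1, 0) : ℝ × ℝ) ∈ triangleT by simp [triangleT])
      (show ((0, 1) : ℝ × ℝ) ∈ triangleT by simp [triangleT])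
      (by norm_num : (0 : ℝ) ≤ 1 / 2) (by norm_num : (0 : ℝ) ≤ 1 / 2) (by norm_num)
    have h2 := hf.2 (show (0 : ℝ) ∈ Set.Icc 0 1 by simp) (show (1 : ℝ) ∈ Set.Icc 0 1 by simp)
      (by norm_num : (0 : ℝ) ≤ 1 / 2) (by norm_num : (0 : ℝ) ≤ 1 / 2) (by norm_num)
    simp [hf0, hf1, hF01, hF10] at h1 h2
    rw [hq1]
    norm_num at h1 h2 ⊢
    have hd' : (d : ℝ) ≤ 2 := by exact_mod_cast hd2
    have hd1 : (1 : ℝ) ≤ d := by exact_mod_cast hd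
    have h3 : 2 * ((d : ℝ) - 1) / d ≤ 1 := by
      rw [div_le_one (by linarith)]
      linarith
    have h4 := mul_le_mul_of_nonneg_right h3 h2
    linarith
  · have hcf : ContinuousAt f q := by
      refine (hf.continuousOn_interior).continuousAt (isOpen_interior.mem_nhds ?_)
      rw [interior_Icc]
      exact ⟨hq0, by linarith⟩
    -- Concavity along the diagonal gives continuity of `F (t, t) - f t` at interior points, hence
    -- of `F (t, t)`.
    have hg : ConcaveOn ℝ (Set.Icc (0 : ℝ) (1 / 2)) fun t => F (t, t) - f t := by
      refine ⟨convex_Icc _ _, fun x hx y hy a b ha hb hab => ?_⟩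
      have := hFx.2 (x := (x, x)) (y := (y, y)) ⟨hx.1, hx.1, by linarith [hx.2]⟩
        ⟨hy.1, hy.1, by linarith [hy.2]⟩ ha hb hab
      simpa using this
    have hcg : ContinuousAt (fun t => F (t, t) - f t) q := by
      refine (hg.continuousOn_interior).continuousAt (isOpen_interior.mem_nhds ?_)
      rw [interior_Icc]
      exact ⟨hq0, hq1⟩
    have hc : ContinuousAt (fun t => F (t, t)) q := by
      refine (hcg.add hcf).congr (Filter.Eventually.of_forall fun t => ?_)
      simp
    have : (nhdsWithin q (edgeInequalitySet d)).NeBot := mem_closure_iff_nhdsWithin_neBot.1 hq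
    refine le_of_tendsto_of_tendsto (b := nhdsWithin q (edgeInequalitySet d))
      ((hcf.const_mul _).mono_left nhdsWithin_le_nhds)
      (hc.mono_left nhdsWithin_le_nhds) ?_
    filter_upwards [self_mem_nhdsWithin] with t ht
    exact ht.2 f F hf hf0 hf1 hF00 hF01 hF10 hFx hFy

end Closure

theorem lemma4p4 {V : Type*} (G : SimpleGraph V) [G.LocallyFinite] (d : ℕ) (hd : 1 ≤ d)
    (hG : G.IsTree) (hreg : G.IsRegularOfDegree d)
    (f : ℝ → ℝ) (hf : ConcaveOn ℝ (Set.Icc 0 1) f) (hf0 : f 0 = 0) (hf1 : f 1 = 0)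
    (F : ℝ × ℝ → ℝ) (hF00 : F (0, 0) = 0) (hF01 : F (0, 1) = 0) (hF10 : F (1, 0) = 0)
    (hFx : ConcaveOn ℝ triangleT (fun p => F p - f p.1))
    (hFy : ConcaveOn ℝ triangleT (fun p => F p - f p.2)) :
    (∀ q ∈ fiidIndepDensities G, 2 * ((d : ℝ) - 1) / d * f q ≤ F (q, q)) ∧
    (∀ q : ℝ, IsLUB (fiidIndepDensities G) q → 2 * ((d : ℝ) - 1) / d * f q ≤ F (q, q)) := by
  have hsub := fiidIndepDensities_subset_closure hd hG hreg
  have key : ∀ q ∈ closure (edgeInequalitySet d), 2 * ((d : ℝ) - 1) / d * f q ≤ F (q, q) :=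
    fun q hq => (closure_edgeInequalitySet_subset hd hq).2 f F hf hf0 hf1 hF00 hF01 hF10 hFx hFy
  exact ⟨fun q hq => key q (hsub hq), fun q hq =>
    key q (closure_minimal hsub isClosed_closure (hq.mem_closure hq.nonempty))⟩
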